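/- Let $X$ be a nonempty compact Hausdorff space. Let $\mathcal L$ be a two-sorted first-order language with a home sort $\mathsf H$ and a space sort $\mathsf S$, whose symbols are: those of an arbitrary first-order language $\mathcal L_{\mathsf H}$ of sort $\mathsf H$; for each $n\ge 1$, a predicate symbol of sort $\mathsf S^n$ for every closed $C\subseteq X^n$; for each $n\ge 0$, a function symbol of sort $\mathsf S^n\to\mathsf S$ for every continuous $f\colon X^n\to X$; and arbitrary sets of function symbols of sort $\mathsf H^n\to\mathsf S$, $n\ge 1$. A standard structure is an $\mathcal L$-structure $\langle M,X\rangle$, with $M$ nonempty, in which the symbols for closed subsets of $X^n$ and continuous functions on $X^n$ have their intended interpretation in $X$; it is denoted by $M$. Let $\mathcal F$ be the least set of $\mathcal L$-formulas that contains all $\mathcal L_{\mathsf H}$-formulas and all formulas $t\in C$, where $C\subseteq X^n$ is closed, $n\ge1$, and $t$ is an $n$-tuple of terms of sort $\mathsf S$, and that is closed under $\wedge$, $\vee$ and the quantifiers $\forall,\exists$ of both sorts. For a set $A$ of elements of a standard structure, $\mathcal F(A)$ is the corresponding set of formulas when a constant of sort $\mathsf H$ is added for each element of $A$. For $\varphi,\varphi'\in\mathcal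 F$ write $\varphi'>\varphi$ if $\varphi'$ is obtained from $\varphi$ by replacing each atomic formula $t\in C$ occurring in $\varphi$ by $t\in C'$ for some closed neighbourhood $C'$ of $C$ (so $\varphi>\varphi$ if no such formula occurs). Write $\varphi\to\psi$ if this implication is valid in all standard structures. The language $\mathcal L$ is separable if there is a countable $\mathcal F_0\subseteq\mathcal F$ such that for all $\varphi\in\mathcal F$ and all $\varphi'>\varphi$ there is $\varphi_0\in\mathcal F_0$ with $\varphi\to\varphi_0\to\varphi'$. Let $\mathcal U$ be a monster model, that is, a standard structure of cardinality $|\mathcal U|>|\mathcal L|$ (where $|\mathcal L|$ is the number of $\mathcal L$-formulas) which is $\mathcal F$-saturated: for every $A\subseteq\mathcal U$ with $|A|<|\mathcal U|$, every set $p(x;\eta)\subseteq\mathcal F(A)$, in finite tuples of variables $x$ of sort $\mathsf H$ and $\eta$ of sort $\mathsf S$, that is finitely realized in $\mathcal U$ is realized in $\mathcal U$. A model is a standard structure $M$ that is a substructure of $\mathcal U$ such that $M\models\varphi(a)$ implies $\mathcal U\models\varphi(a)$ for every $\varphi(x)\in\mathcal F$ whose free variables are all of sort $\mathsf H$ and every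 tuple $a$ in $M$. **Proposition.** If $\mathcal L$ is separable, then for every countable $A\subseteq\mathcal U$ there is a countable model $M$ with $A\subseteq M$. -/

import Mathlib

open Topology Cardinal

universe u

/-- A two-sorted language over the space `X`, with a home sort `H` and a space sort `S`:
an arbitrary first-order language `home` for the sort `H`, together with a set `toSpace m` of
function symbols of sort `H ^ (m + 1) → S` for each `m`. The symbols of the space sort are
determined by `X` and need not be listed: every continuous function `X ^ n → X`, `0 ≤ n`, and
every closed subset of `X ^ n`, `1 ≤ n`. -/
structure TwoSortedLanguage (X : Type u) where
  home : FirstOrder.Language.{u, u}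
  toSpace : ℕ → Type u

namespace TwoSortedLanguage

variable {X : Type u}

/-- A standard structure `⟨M, X⟩`: the symbols of the space sort have their intended meaning
in `X`, so the data are an interpretation in `M` of the home language and an interpretation of the
function symbols of sort `H ^ (m + 1) → S`. -/
class StandardStructure (L : TwoSortedLanguage X) (M : Type u) extends L.home.Structure M where
  spaceMap : ∀ {m : ℕ}, L.toSpace m → (Fin (m + 1) → M) → X

/-- A subset of a standard structure closed under the function symbols of the home language,
with the restricted interpretations. -/
instance substructureStandardStructure (L : TwoSortedLanguage X) (M : Type u)
    [L.StandardStructure M] (S : L.home.Substructure M) : L.StandardStructure S where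
  spaceMap f a := StandardStructure.spaceMap f (fun i => (a i : M))

variable [TopologicalSpace X]

/-- Terms of sort `S`, in the language expanded by a constant of sort `H` for each element of `α`,
with `n` variables of sort `H` and `k` variables of sort `S`. -/
inductive SpaceTerm (L : TwoSortedLanguage X) (α : Type u) (n k : ℕ) : Type u
  | var (i : Fin k) : SpaceTerm L α n k
  | ofHome {m : ℕ} (f : L.toSpace m) (t : Fin (m + 1) → L.home.Term (α ⊕ Fin n)) :
      SpaceTerm L α n k
  | func {m : ℕ} (f : C(Fin m → X, X)) (t : Fin m → SpaceTerm L α n k) : SpaceTerm L α n k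

/-- The set `𝓕` of formulas, in the language expanded by a constant of sort `H` for each element of
`α`, with free variables among `n` variables of sort `H` and `k` variables of sort `S`.
It contains all formulas of the home language and all formulas `t ∈ C`, and is
closed under conjunction, disjunction and the quantifiers of both sorts. A quantifier binds the
last variable of its sort. -/
inductive FFormula (L : TwoSortedLanguage X) (α : Type u) : ℕ → ℕ → Type u
  | home {n k : ℕ} (φ : L.home.BoundedFormula α n) : FFormula L α n k
  | mem {n k m : ℕ} (t : Fin (m + 1) → L.SpaceTerm α n k)
      (C : TopologicalSpace.Closeds (Fin (m + 1) → X)) : FFormula L α n k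
  | and {n k : ℕ} (φ ψ : FFormula L α n k) : FFormula L α n k
  | or {n k : ℕ} (φ ψ : FFormula L α n k) : FFormula L α n k
  | allHome {n k : ℕ} (φ : FFormula L α (n + 1) k) : FFormula L α n k
  | exHome {n k : ℕ} (φ : FFormula L α (n + 1) k) : FFormula L α n k
  | allSpace {n k : ℕ} (φ : FFormula L α n (k + 1)) : FFormula L α n k
  | exSpace {n k : ℕ} (φ : FFormula L α n (k + 1)) : FFormula L α n k

section Semantics

variable {L : TwoSortedLanguage X} {α : Type u} {M : Type u} [L.StandardStructure M]

/-- The value of a term of sort `S`; `c` interprets the added constants, `a` the home variables,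
`ξ` the space variables. -/
def SpaceTerm.realize {n k : ℕ} (c : α → M) (a : Fin n → M) (ξ : Fin k → X) :
    L.SpaceTerm α n k → X
  | .var i => ξ i
  | .ofHome f t => StandardStructure.spaceMap f (fun i => (t i).realize (Sum.elim c a))
  | .func f t => f (fun i => (t i).realize c a ξ)

/-- Truth of an `𝓕`-formula in a standard structure. -/
def FFormula.Realize (c : α → M) :
    {n k : ℕ} → L.FFormula α n k → (Fin n → M) → (Fin k → X) → Prop
  | _, _, .home φ, a, _ => φ.Realize c a
  | _, _, .mem t C, a, ξ => (fun i => (t i).realize c a ξ) ∈ C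
  | _, _, .and φ ψ, a, ξ => φ.Realize c a ξ ∧ ψ.Realize c a ξ
  | _, _, .or φ ψ, a, ξ => φ.Realize c a ξ ∨ ψ.Realize c a ξ
  | _, _, .allHome φ, a, ξ => ∀ b : M, φ.Realize c (Fin.snoc a b) ξ
  | _, _, .exHome φ, a, ξ => ∃ b : M, φ.Realize c (Fin.snoc a b) ξ
  | _, _, .allSpace φ, a, ξ => ∀ β : X, φ.Realize c a (Fin.snoc ξ β)
  | _, _, .exSpace φ, a, ξ => ∃ β : X, φ.Realize c a (Fin.snoc ξ β)

end Semantics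

/-- `IsApprox φ φ'` means `φ' > φ`: the formula `φ'` arises from `φ` by replacing each atomic
formula `t ∈ C` by `t ∈ C'` for some closed neighbourhood `C'` of `C`. -/
inductive FFormula.IsApprox {L : TwoSortedLanguage X} {α : Type u} :
    {n k : ℕ} → L.FFormula α n k → L.FFormula α n k → Prop
  | home {n k : ℕ} (φ : L.home.BoundedFormula α n) :
      IsApprox (.home φ : L.FFormula α n k) (.home φ)
  | mem {n k m : ℕ} (t : Fin (m + 1) → L.SpaceTerm α n k)
      (C C' : TopologicalSpace.Closeds (Fin (m + 1) → X))
      (h : (C' : Set (Fin (m + 1) → X)) ∈ 𝓝ˢ (C : Set (Fin (m + 1) → X))) :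
      IsApprox (.mem t C) (.mem t C')
  | and {n k : ℕ} {φ ψ φ' ψ' : L.FFormula α n k} :
      IsApprox φ φ' → IsApprox ψ ψ' → IsApprox (.and φ ψ) (.and φ' ψ')
  | or {n k : ℕ} {φ ψ φ' ψ' : L.FFormula α n k} :
      IsApprox φ φ' → IsApprox ψ ψ' → IsApprox (.or φ ψ) (.or φ' ψ')
  | allHome {n k : ℕ} {φ φ' : L.FFormula α (n + 1) k} :
      IsApprox φ φ' → IsApprox (.allHome φ) (.allHome φ')
  | exHome {n k : ℕ} {φ φ' : L.FFormula α (n + 1) k} :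
      IsApprox φ φ' → IsApprox (.exHome φ) (.exHome φ')
  | allSpace {n k : ℕ} {φ φ' : L.FFormula α n (k + 1)} :
      IsApprox φ φ' → IsApprox (.allSpace φ) (.allSpace φ')
  | exSpace {n k : ℕ} {φ φ' : L.FFormula α n (k + 1)} :
      IsApprox φ φ' → IsApprox (.exSpace φ) (.exSpace φ')

/-- `φ → ψ`: the implication is valid in all standard structures (with nonempty home sort, as
usual in first-order logic). No constants are added to the language here. -/
def Implies (L : TwoSortedLanguage X) {n k : ℕ} (φ ψ : L.FFormula PEmpty.{u + 1} n k) : Prop :=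
  ∀ (M : Type u) [Nonempty M] [L.StandardStructure M] (a : Fin n → M) (ξ : Fin k → X),
    φ.Realize PEmpty.elim a ξ → ψ.Realize PEmpty.elim a ξ

/-- `L` is separable: there is a countable set `F₀` of `𝓕`-formulas such that whenever `φ' > φ`
some `φ₀ ∈ F₀` satisfies `φ → φ₀ → φ'`. -/
def IsSeparable (L : TwoSortedLanguage X) : Prop :=
  ∃ F₀ : Set (Σ nk : ℕ × ℕ, L.FFormula PEmpty.{u + 1} nk.1 nk.2), F₀.Countable ∧
    ∀ (n k : ℕ) (φ φ' : L.FFormula PEmpty.{u + 1} n k), φ.IsApprox φ' →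
      ∃ φ₀ : L.FFormula PEmpty.{u + 1} n k,
        (⟨(n, k), φ₀⟩ : Σ nk : ℕ × ℕ, L.FFormula PEmpty.{u + 1} nk.1 nk.2) ∈ F₀ ∧
        L.Implies φ φ₀ ∧ L.Implies φ₀ φ'

/-- The cardinality of the full language, that is, of its set of formulas. -/
noncomputable def card (L : TwoSortedLanguage X) : Cardinal.{u} :=
  max ℵ₀ (L.home.card + #(Σ m : ℕ, L.toSpace m) + #(Σ n : ℕ, C(Fin n → X, X)) +
    #(Σ n : ℕ, TopologicalSpace.Closeds (Fin (n + 1) → X)))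

/-- `N` is `κ`-`𝓕`-saturated: every type `p(x; η) ⊆ 𝓕(A)`, where `A ⊆ N` has fewer than `κ`
elements, that is finitely realized in `N` is realized in `N`. -/
def IsFSaturatedOf (L : TwoSortedLanguage X) (κ : Cardinal.{u}) (N : Type u)
    [L.StandardStructure N] : Prop :=
  ∀ A : Set N, #A < κ → ∀ (n k : ℕ) (p : Set (L.FFormula A n k)),
    (∀ q : Set (L.FFormula A n k), q ⊆ p → q.Finite →
      ∃ (a : Fin n → N) (ξ : Fin k → X), ∀ φ ∈ q, φ.Realize (fun c : A => (c : N)) a ξ) →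
    ∃ (a : Fin n → N) (ξ : Fin k → X), ∀ φ ∈ p, φ.Realize (fun c : A => (c : N)) a ξ

/-- `N` is `𝓕`-saturated: it is `|N|`-`𝓕`-saturated. -/
def IsFSaturated (L : TwoSortedLanguage X) (N : Type u) [L.StandardStructure N] : Prop :=
  L.IsFSaturatedOf #N N

/-- A monster model: an `𝓕`-saturated standard structure of cardinality larger than that of the
language. -/
def IsMonster (L : TwoSortedLanguage X) (U : Type u) [L.StandardStructure U] : Prop :=
  L.card < #U ∧ L.IsFSaturated U

/-- A (total) map is an `𝓕`-elementary embedding if it preserves the truth of all `𝓕`-formulas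
whose free variables are of the home sort. -/
def IsFElementary (L : TwoSortedLanguage X) {M N : Type u} [L.StandardStructure M]
    [L.StandardStructure N] (f : M → N) : Prop :=
  ∀ (n : ℕ) (φ : L.FFormula PEmpty.{u + 1} n 0) (a : Fin n → M) (ξ : Fin 0 → X),
    φ.Realize PEmpty.elim a ξ → φ.Realize PEmpty.elim (fun i => f (a i)) ξ

/-- A model: a (nonempty) `𝓕`-elementary substructure of the monster. -/
def IsModel (L : TwoSortedLanguage X) {U : Type u} [L.StandardStructure U]
    (M : L.home.Substructure U) : Prop :=
  (M : Set U).Nonempty ∧ L.IsFElementary (fun a : M => (a : U))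

end TwoSortedLanguage

/-!
The proof is a downward Löwenheim–Skolem argument in which the Tarski–Vaught test holds only up to
approximation.

Call `N ⊆ U` a Tarski–Vaught set (`IsTarskiVaught`) if, whenever `∃ x, φ(x)` is true in `U` for an
`𝓕`-formula `φ` with parameters in `N` and no free space variables, every `φ' > φ` has a witness
in `N`. If `φ → φ₀ → φ'` with `φ₀ ∈ F₀`, then any witness of `φ₀` is a witness of `φ'`. Hence it
suffices to close `A` under Skolem functions for the countably many formulas of `F₀`
(`IsSeparable.exists_isTarskiVaught`).

Every home formula is its own only approximation, so a Tarski–Vaught set is an elementary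
substructure for the home language. For general `𝓕`-formulas, truth passes from the set to `U` up to
approximation: `M ⊨ φ` implies `U ⊨ φ'` for all `φ' > φ`
(`IsTarskiVaught.realize_of_isApprox`). Since `𝓕` lacks negation, the universal home quantifier
is handled by formulas that separate `φ` from `¬φ'`
(`FFormula.IsApprox.exists_strong_negation`, which rests on the normality of `X ^ n`).
Space quantifiers are harmless because both structures have the same space sort `X`, and the points
of `X` that instantiate them become closed terms, as constants are continuous functions of
arity `0`.

Finally, in the saturated structure `U` a formula follows from its approximations
(`IsFSaturated.realize_of_forall_isApprox`), which turns approximate preservation into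
preservation.
-/

namespace TwoSortedLanguage

/-! ### Change of constants and substitution of points of `X` -/

section Substitution

variable {X : Type u}

/-- The extension of a substitution of space variables that keeps one further variable, the
last. -/
def liftSubst {k l : ℕ} (σ : Fin k → Fin l ⊕ X) : Fin (k + 1) → Fin (l + 1) ⊕ X :=
  Fin.snoc (fun i => (σ i).map Fin.castSucc id) (.inl (Fin.last l))

theorem elim_liftSubst {k l : ℕ} (σ : Fin k → Fin l ⊕ X) (ξ : Fin l → X) (x : X) :
    (fun i => Sum.elim (Fin.snoc ξ x : Fin (l + 1) → X) id (liftSubst σ i)) =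
      Fin.snoc (fun i => Sum.elim ξ id (σ i)) x := by
  funext i
  refine Fin.lastCases ?_ (fun i => ?_) i
  · simp [liftSubst]
  · simp only [liftSubst, Fin.snoc_castSucc]
    cases σ i <;> simp

variable [TopologicalSpace X] {L : TwoSortedLanguage X} {α β M : Type u}
  [L.StandardStructure M]

/-- Rename the added constants along `g`, and replace the space variable `i` by `σ i`, which is
either a space variable or a point of `X`. Points are written as continuous functions of
arity `0`. -/
def SpaceTerm.subst {n k l : ℕ} (g : α → β) (σ : Fin k → Fin l ⊕ X) :
    L.SpaceTerm α n k → L.SpaceTerm β n l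
  | .var i => Sum.elim .var (fun x => .func (ContinuousMap.const (Fin 0 → X) x) Fin.elim0) (σ i)
  | .ofHome f t => .ofHome f fun i => (t i).relabel (Sum.map g id)
  | .func f t => .func f fun i => (t i).subst g σ

/-- Rename the added constants along `g`, and replace the free space variable `i` by `σ i`, which
is either a space variable or a point of `X`. -/
def FFormula.subst (g : α → β) :
    {n k l : ℕ} → (Fin k → Fin l ⊕ X) → L.FFormula α n k → L.FFormula β n l
  | _, _, _, _, .home φ => .home (φ.subst fun a => .var (g a))
  | _, _, _, σ, .mem t C => .mem (fun i => (t i).subst g σ) C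
  | _, _, _, σ, .and φ ψ => .and (φ.subst g σ) (ψ.subst g σ)
  | _, _, _, σ, .or φ ψ => .or (φ.subst g σ) (ψ.subst g σ)
  | _, _, _, σ, .allHome φ => .allHome (φ.subst g σ)
  | _, _, _, σ, .exHome φ => .exHome (φ.subst g σ)
  | _, _, _, σ, .allSpace φ => .allSpace (φ.subst g (liftSubst σ))
  | _, _, _, σ, .exSpace φ => .exSpace (φ.subst g (liftSubst σ))

theorem SpaceTerm.realize_subst {n k l : ℕ} (g : α → β) (σ : Fin k → Fin l ⊕ X)
    (t : L.SpaceTerm α n k) (c : β → M) (a : Fin n → M) (ξ : Fin l → X) :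
    (t.subst g σ).realize c a ξ = t.realize (c ∘ g) a (fun i => Sum.elim ξ id (σ i)) := by
  induction t with
  | var i =>
    simp only [SpaceTerm.subst, SpaceTerm.realize]
    cases σ i <;> simp [SpaceTerm.realize]
  | ofHome f t =>
    simp only [SpaceTerm.subst, SpaceTerm.realize, FirstOrder.Language.Term.realize_relabel,
      Sum.elim_comp_map, Function.comp_id]
  | func f t ih => simp only [SpaceTerm.subst, SpaceTerm.realize, ih]

theorem FFormula.realize_subst (g : α → β) (c : β → M) {n k l : ℕ} (σ : Fin k → Fin l ⊕ X)
    (φ : L.FFormula α n k) (a : Fin n → M) (ξ : Fin l → X) :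
    (φ.subst g σ).Realize c a ξ ↔ φ.Realize (c ∘ g) a (fun i => Sum.elim ξ id (σ i)) := by
  induction φ generalizing l with
  | home φ =>
    simp only [FFormula.subst, FFormula.Realize, FirstOrder.Language.BoundedFormula.realize_subst]
    rfl
  | mem t C => simp only [FFormula.subst, FFormula.Realize, SpaceTerm.realize_subst]
  | and φ ψ ih₁ ih₂ => simp only [FFormula.subst, FFormula.Realize, ih₁, ih₂]
  | or φ ψ ih₁ ih₂ => simp only [FFormula.subst, FFormula.Realize, ih₁, ih₂]
  | allHome φ ih => simp only [FFormula.subst, FFormula.Realize, ih]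
  | exHome φ ih => simp only [FFormula.subst, FFormula.Realize, ih]
  | allSpace φ ih => simp only [FFormula.subst, FFormula.Realize, ih, elim_liftSubst]
  | exSpace φ ih => simp only [FFormula.subst, FFormula.Realize, ih, elim_liftSubst]

theorem FFormula.IsApprox.subst (g : α → β) {n k l : ℕ} (σ : Fin k → Fin l ⊕ X)
    {φ φ' : L.FFormula α n k} (h : φ.IsApprox φ') : (φ.subst g σ).IsApprox (φ'.subst g σ) := by
  induction h generalizing l with
  | home φ => exact .home _
  | mem t C C' h => exact .mem _ C C' h
  | and _ _ ih₁ ih₂ => exact .and (ih₁ σ) (ih₂ σ)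
  | or _ _ ih₁ ih₂ => exact .or (ih₁ σ) (ih₂ σ)
  | allHome _ ih => exact .allHome (ih σ)
  | exHome _ ih => exact .exHome (ih σ)
  | allSpace _ ih => exact .allSpace (ih _)
  | exSpace _ ih => exact .exSpace (ih _)

end Substitution

/-! ### Approximations of a formula -/

section Approximation

variable {X : Type u} [TopologicalSpace X] {L : TwoSortedLanguage X} {α M : Type u}
  [L.StandardStructure M]

theorem FFormula.exists_isApprox {n k : ℕ} (φ : L.FFormula α n k) : ∃ φ', φ.IsApprox φ' := by
  induction φ with
  | home φ => exact ⟨_, .home φ⟩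
  | mem t C => exact ⟨_, .mem t C ⊤ (by simp)⟩
  | and _ _ ih₁ ih₂ => exact ⟨_, .and ih₁.choose_spec ih₂.choose_spec⟩
  | or _ _ ih₁ ih₂ => exact ⟨_, .or ih₁.choose_spec ih₂.choose_spec⟩
  | allHome _ ih => exact ⟨_, .allHome ih.choose_spec⟩
  | exHome _ ih => exact ⟨_, .exHome ih.choose_spec⟩
  | allSpace _ ih => exact ⟨_, .allSpace ih.choose_spec⟩
  | exSpace _ ih => exact ⟨_, .exSpace ih.choose_spec⟩

/-- The approximations of a formula are directed: closed neighbourhoods of a set may be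
intersected. -/
theorem FFormula.IsApprox.exists_le_le (c : α → M) {n k : ℕ} {φ φ₁ φ₂ : L.FFormula α n k}
    (h₁ : φ.IsApprox φ₁) (h₂ : φ.IsApprox φ₂) :
    ∃ φ', φ.IsApprox φ' ∧
      ∀ (a : Fin n → M) (ξ : Fin k → X),
        φ'.Realize c a ξ → φ₁.Realize c a ξ ∧ φ₂.Realize c a ξ := by
  induction h₁ with
  | home φ =>
    cases h₂
    exact ⟨_, .home φ, fun _ _ h => ⟨h, h⟩⟩
  | mem t C C₁ h₁ =>
    cases h₂ with
    | mem _ _ C₂ h₂ =>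
      exact ⟨_, .mem t C (C₁ ⊓ C₂) (Filter.inter_mem h₁ h₂), fun _ _ h => ⟨h.1, h.2⟩⟩
  | and _ _ ih ih' =>
    cases h₂ with
    | and h h' =>
      obtain ⟨χ, hχ, H⟩ := ih h
      obtain ⟨χ', hχ', H'⟩ := ih' h'
      exact ⟨_, .and hχ hχ', fun a ξ w =>
        ⟨⟨(H a ξ w.1).1, (H' a ξ w.2).1⟩, ⟨(H a ξ w.1).2, (H' a ξ w.2).2⟩⟩⟩
  | or _ _ ih ih' =>
    cases h₂ with
    | or h h' =>
      obtain ⟨χ, hχ, H⟩ := ih h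
      obtain ⟨χ', hχ', H'⟩ := ih' h'
      refine ⟨_, .or hχ hχ', fun a ξ w => ?_⟩
      rcases w with w | w
      · exact ⟨.inl (H a ξ w).1, .inl (H a ξ w).2⟩
      · exact ⟨.inr (H' a ξ w).1, .inr (H' a ξ w).2⟩
  | allHome _ ih =>
    cases h₂ with
    | allHome h =>
      obtain ⟨χ, hχ, H⟩ := ih h
      exact ⟨_, .allHome hχ, fun a ξ w => ⟨fun b => (H _ ξ (w b)).1, fun b => (H _ ξ (w b)).2⟩⟩
  | exHome _ ih =>
    cases h₂ with
    | exHome h =>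
      obtain ⟨χ, hχ, H⟩ := ih h
      exact ⟨_, .exHome hχ, fun a ξ ⟨b, w⟩ => ⟨⟨b, (H _ ξ w).1⟩, ⟨b, (H _ ξ w).2⟩⟩⟩
  | allSpace _ ih =>
    cases h₂ with
    | allSpace h =>
      obtain ⟨χ, hχ, H⟩ := ih h
      exact ⟨_, .allSpace hχ, fun a ξ w => ⟨fun b => (H a _ (w b)).1, fun b => (H a _ (w b)).2⟩⟩
  | exSpace _ ih =>
    cases h₂ with
    | exSpace h =>
      obtain ⟨χ, hχ, H⟩ := ih h
      exact ⟨_, .exSpace hχ, fun a ξ ⟨b, w⟩ => ⟨⟨b, (H a _ w).1⟩, ⟨b, (H a _ w).2⟩⟩⟩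

theorem FFormula.exists_isApprox_forall_mem (c : α → M) {n k : ℕ} (φ : L.FFormula α n k)
    {q : Set (L.FFormula α n k)} (hq : q.Finite) (h : ∀ χ ∈ q, φ.IsApprox χ) :
    ∃ φ', φ.IsApprox φ' ∧
      ∀ (a : Fin n → M) (ξ : Fin k → X), φ'.Realize c a ξ → ∀ χ ∈ q, χ.Realize c a ξ := by
  induction q, hq using Set.Finite.induction_on with
  | empty =>
    obtain ⟨φ', h'⟩ := φ.exists_isApprox
    exact ⟨φ', h', by simp⟩
  | @insert χ q _ _ ih =>
    obtain ⟨φ₁, h₁, H₁⟩ := ih fun χ hχ => h χ (Set.mem_insert_of_mem _ hχ)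
    obtain ⟨φ₂, h₂, H₂⟩ := (h χ (Set.mem_insert _ _)).exists_le_le c h₁
    refine ⟨φ₂, h₂, fun a ξ w => ?_⟩
    rintro χ' (rfl | hχ')
    · exact (H₂ a ξ w).1
    · exact H₁ a ξ (H₂ a ξ w).2 χ' hχ'

/-- The class of `𝓕`-formulas is not closed under negation, but for `φ' > φ` it separates `φ`
from `¬φ'` with room on both sides: there are `φ'' > φ` and `ψ' > ψ` such that `¬φ' → ψ` and
`ψ' → ¬φ''`. The formula `ψ` is obtained by dualizing connectives and quantifiers and by replacing
`t ∈ C'` with `t ∉ interior C'`. -/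
theorem FFormula.IsApprox.exists_strong_negation [CompactSpace X] [T2Space X] (c : α → M)
    {n k : ℕ} {φ φ' : L.FFormula α n k} (h : φ.IsApprox φ') :
    ∃ φ'' ψ ψ' : L.FFormula α n k, φ.IsApprox φ'' ∧ ψ.IsApprox ψ' ∧
      ∀ (a : Fin n → M) (ξ : Fin k → X),
        (φ'.Realize c a ξ ∨ ψ.Realize c a ξ) ∧ ¬(φ''.Realize c a ξ ∧ ψ'.Realize c a ξ) := by
  induction h with
  | home φ =>
    refine ⟨_, .home φ.not, _, .home φ, .home _, fun a ξ => ⟨em _, fun w => w.2 w.1⟩⟩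
  | @mem _ _ m t C C' h =>
    let D : TopologicalSpace.Closeds (Fin (m + 1) → X) :=
      ⟨(interior (C' : Set (Fin (m + 1) → X)))ᶜ, isOpen_interior.isClosed_compl⟩
    have hCD : Disjoint (C : Set (Fin (m + 1) → X)) D :=
      Set.disjoint_compl_right_iff_subset.2 (subset_interior_iff_mem_nhdsSet.2 h)
    obtain ⟨u, hu, v, hv, huv⟩ :=
      Filter.disjoint_iff.1 (disjoint_nhdsSet_nhdsSet C.isClosed D.isClosed hCD)
    obtain ⟨E, hE, hEc, hEu⟩ := exists_mem_nhdsSet_isClosed_subset hu C.isClosed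
    obtain ⟨F, hF, hFc, hFv⟩ := exists_mem_nhdsSet_isClosed_subset hv D.isClosed
    refine ⟨_, .mem t D, _, .mem t C ⟨E, hEc⟩ hE, .mem t D ⟨F, hFc⟩ hF, fun a ξ => ⟨?_, ?_⟩⟩
    · by_cases hx : (fun i => (t i).realize c a ξ) ∈ interior (C' : Set (Fin (m + 1) → X))
      · exact .inl (interior_subset hx)
      · exact .inr hx
    · exact fun w => Set.disjoint_left.1 huv (hEu w.1) (hFv w.2)
  | and _ _ ih₁ ih₂ =>
    obtain ⟨φ₁, ψ₁, ψ₁', h₁, h₁', H₁⟩ := ih₁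
    obtain ⟨φ₂, ψ₂, ψ₂', h₂, h₂', H₂⟩ := ih₂
    refine ⟨_, _, _, .and h₁ h₂, .or h₁' h₂', fun a ξ => ?_⟩
    refine ⟨?_, fun ⟨w, w'⟩ => w'.elim (fun w' => (H₁ a ξ).2 ⟨w.1, w'⟩)
      fun w' => (H₂ a ξ).2 ⟨w.2, w'⟩⟩
    rcases (H₁ a ξ).1 with w | w
    · exact (H₂ a ξ).1.imp (⟨w, ·⟩) .inr
    · exact .inr (.inl w)
  | or _ _ ih₁ ih₂ =>
    obtain ⟨φ₁, ψ₁, ψ₁', h₁, h₁', H₁⟩ := ih₁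
    obtain ⟨φ₂, ψ₂, ψ₂', h₂, h₂', H₂⟩ := ih₂
    refine ⟨_, _, _, .or h₁ h₂, .and h₁' h₂', fun a ξ => ?_⟩
    refine ⟨?_, fun ⟨w, w'⟩ => w.elim (fun w => (H₁ a ξ).2 ⟨w, w'.1⟩)
      fun w => (H₂ a ξ).2 ⟨w, w'.2⟩⟩
    rcases (H₁ a ξ).1 with w | w
    · exact .inl (.inl w)
    · exact (H₂ a ξ).1.imp .inr (⟨w, ·⟩)
  | allHome _ ih =>
    obtain ⟨φ₁, ψ, ψ', h, h', H⟩ := ih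
    refine ⟨_, _, _, .allHome h, .exHome h', fun a ξ => ⟨?_, ?_⟩⟩
    · by_contra! hw
      exact hw.1 fun b => (H _ ξ).1.resolve_right fun w => hw.2 ⟨b, w⟩
    · rintro ⟨w, b, w'⟩
      exact (H _ ξ).2 ⟨w b, w'⟩
  | exHome _ ih =>
    obtain ⟨φ₁, ψ, ψ', h, h', H⟩ := ih
    refine ⟨_, _, _, .exHome h, .allHome h', fun a ξ => ⟨?_, ?_⟩⟩
    · by_contra! hw
      exact hw.2 fun b => (H _ ξ).1.resolve_left fun w => hw.1 ⟨b, w⟩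
    · rintro ⟨⟨b, w⟩, w'⟩
      exact (H _ ξ).2 ⟨w, w' b⟩
  | allSpace _ ih =>
    obtain ⟨φ₁, ψ, ψ', h, h', H⟩ := ih
    refine ⟨_, _, _, .allSpace h, .exSpace h', fun a ξ => ⟨?_, ?_⟩⟩
    · by_contra! hw
      exact hw.1 fun b => (H a _).1.resolve_right fun w => hw.2 ⟨b, w⟩
    · rintro ⟨w, b, w'⟩
      exact (H a _).2 ⟨w b, w'⟩
  | exSpace _ ih =>
    obtain ⟨φ₁, ψ, ψ', h, h', H⟩ := ih
    refine ⟨_, _, _, .exSpace h, .allSpace h', fun a ξ => ⟨?_, ?_⟩⟩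
    · by_contra! hw
      exact hw.2 fun b => (H a _).1.resolve_left fun w => hw.1 ⟨b, w⟩
    · rintro ⟨⟨b, w⟩, w'⟩
      exact (H a _).2 ⟨w, w' b⟩

end Approximation

/-! ### Saturation -/

section Saturation

variable {X : Type u} [TopologicalSpace X] {L : TwoSortedLanguage X} {U : Type u}
  [L.StandardStructure U]

theorem IsMonster.infinite (hU : L.IsMonster U) : Infinite U :=
  Cardinal.aleph0_le_mk_iff.1 ((le_max_left _ _).trans hU.1.le)

/-- Saturation for types in which some of the variables are prescribed: those with indices in `I`
and `J` are to take the values given by `a` and `ξ`. -/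
theorem IsFSaturated.exists_realize [Infinite U] [T1Space X] (hU : L.IsFSaturated U) {n k : ℕ}
    (p : Set (L.FFormula PEmpty.{u + 1} n k)) (I : Set (Fin n)) (J : Set (Fin k)) (a : Fin n → U)
    (ξ : Fin k → X)
    (hp : ∀ q ⊆ p, q.Finite → ∃ (b : Fin n → U) (η : Fin k → X),
      (∀ i ∈ I, b i = a i) ∧ (∀ j ∈ J, η j = ξ j) ∧ ∀ φ ∈ q, φ.Realize PEmpty.elim b η) :
    ∃ (b : Fin n → U) (η : Fin k → X),
      (∀ i ∈ I, b i = a i) ∧ (∀ j ∈ J, η j = ξ j) ∧ ∀ φ ∈ p, φ.Realize PEmpty.elim b η := by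
  classical
  let A : Set U := Set.range a
  have hA : #A < #U := (Cardinal.mk_lt_aleph0_iff.2 (Set.finite_range a).to_subtype).trans_le
    (Cardinal.aleph0_le_mk U)
  let τ : L.FFormula PEmpty.{u + 1} n k → L.FFormula A n k :=
    FFormula.subst PEmpty.elim .inl
  have hτ (φ) (b : Fin n → U) (η : Fin k → X) :
      (τ φ).Realize (fun c : A => (c : U)) b η ↔ φ.Realize PEmpty.elim b η := by
    rw [FFormula.realize_subst, Subsingleton.elim ((fun c : A => (c : U)) ∘ _) PEmpty.elim]
    rfl
  -- The prescribed values are enforced by the formulas `xᵢ = aᵢ` and `ηⱼ ∈ {ξⱼ}`.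
  let e : Fin n → L.FFormula A n k := fun i =>
    .home (FirstOrder.Language.Term.bdEqual (.var (.inr i)) (.var (.inl ⟨a i, i, rfl⟩)))
  let d : Fin k → L.FFormula A n k := fun j =>
    .mem (m := 0) (fun _ => .var j) ⟨{fun _ => ξ j}, isClosed_singleton⟩
  have he (i) (b : Fin n → U) (η : Fin k → X) :
      (e i).Realize (fun c : A => (c : U)) b η ↔ b i = a i := Iff.rfl
  have hd (j) (b : Fin n → U) (η : Fin k → X) :
      (d j).Realize (fun c : A => (c : U)) b η ↔ η j = ξ j :=
    ⟨fun h => congrFun h 0, fun h => funext fun _ => h⟩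
  obtain ⟨b, η, h⟩ := hU A hA n k (τ '' p ∪ e '' I ∪ d '' J) (fun q hq hqf => by
    obtain ⟨s, hsp, hs⟩ := Finset.subset_set_image_iff (s := p) (f := τ)
      (t := (hqf.inter_of_left (τ '' p)).toFinset) |>.1 (by simp)
    obtain ⟨b, η, hb, hη, H⟩ := hp s hsp s.finite_toSet
    refine ⟨b, η, fun φ hφ => ?_⟩
    rcases hq hφ with (hφ' | ⟨i, hi, rfl⟩) | ⟨j, hj, rfl⟩
    · have : φ ∈ s.image τ := by rw [hs]; simpa using ⟨hφ, hφ'⟩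
      obtain ⟨χ, hχ, rfl⟩ := Finset.mem_image.1 this
      exact (hτ _ _ _).2 (H χ hχ)
    · exact (he _ _ _).2 (hb i hi)
    · exact (hd _ _ _).2 (hη j hj))
  exact ⟨b, η, fun i hi => (he i b η).1 (h _ (.inl (.inr ⟨i, hi, rfl⟩))),
    fun j hj => (hd j b η).1 (h _ (.inr ⟨j, hj, rfl⟩)),
    fun φ hφ => (hτ φ b η).1 (h _ (.inl (.inl ⟨φ, hφ, rfl⟩)))⟩

/-- In an `𝓕`-saturated structure a formula is equivalent to the conjunction of its
approximations. -/
theorem IsFSaturated.realize_of_forall_isApprox [CompactSpace X] [T2Space X] [Infinite U]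
    (hU : L.IsFSaturated U) {n k : ℕ} (φ : L.FFormula PEmpty.{u + 1} n k) (a : Fin n → U)
    (ξ : Fin k → X) (h : ∀ φ', φ.IsApprox φ' → φ'.Realize PEmpty.elim a ξ) :
    φ.Realize PEmpty.elim a ξ := by
  induction φ with
  | home φ => exact h _ (.home φ)
  | mem t C =>
    by_contra hx
    obtain ⟨E, hE, hEc, hEu⟩ := exists_mem_nhdsSet_isClosed_subset
      ((isOpen_compl_singleton (x := fun i => (t i).realize PEmpty.elim a ξ)).mem_nhdsSet.2
        (Set.subset_compl_singleton_iff.2 hx) : _ ∈ 𝓝ˢ (C : Set _)) C.isClosed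
    exact hEu (h _ (.mem t C ⟨E, hEc⟩ hE)) rfl
  | and φ ψ ih₁ ih₂ =>
    obtain ⟨φ₀, hφ₀⟩ := φ.exists_isApprox
    obtain ⟨ψ₀, hψ₀⟩ := ψ.exists_isApprox
    exact ⟨ih₁ a ξ fun φ' h' => (h _ (.and h' hψ₀)).1, ih₂ a ξ fun ψ' h' => (h _ (.and hφ₀ h')).2⟩
  | or φ ψ ih₁ ih₂ =>
    by_contra hw
    have h₁ := mt (ih₁ a ξ) fun w => hw (.inl w)
    have h₂ := mt (ih₂ a ξ) fun w => hw (.inr w)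
    push Not at h₁ h₂
    obtain ⟨φ', hφ', w₁⟩ := h₁
    obtain ⟨ψ', hψ', w₂⟩ := h₂
    exact (h _ (.or hφ' hψ')).elim w₁ w₂
  | allHome φ ih => exact fun b => ih _ ξ fun φ' h' => h _ (.allHome h') b
  | allSpace φ ih => exact fun β => ih a _ fun φ' h' => h _ (.allSpace h') β
  | @exHome n k φ ih =>
    obtain ⟨b, η, hb, hη, H⟩ := hU.exists_realize {φ' | φ.IsApprox φ'}
      (Set.range Fin.castSucc) Set.univ (Fin.snoc a (Classical.arbitrary U)) ξ (fun q hq hqf => by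
        obtain ⟨φ', h', H⟩ := φ.exists_isApprox_forall_mem (M := U) PEmpty.elim hqf hq
        obtain ⟨b, hb⟩ := h _ (.exHome h')
        exact ⟨_, ξ, by rintro _ ⟨i, rfl⟩; simp, by simp, H _ _ hb⟩)
    obtain rfl : η = ξ := funext fun j => hη j trivial
    obtain rfl : Fin.init b = a := funext fun i => by simpa [Fin.init] using hb i.castSucc ⟨i, rfl⟩
    refine ⟨b (Fin.last n), ih _ _ fun φ' h' => ?_⟩
    rw [Fin.snoc_init_self]
    exact H φ' h'
  | @exSpace n k φ ih =>
    -- An arbitrary value for the last space variable, taken from an instance of `h`.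
    obtain ⟨φ₀, hφ₀⟩ := φ.exists_isApprox
    obtain ⟨β₀, -⟩ := h _ (.exSpace hφ₀)
    obtain ⟨b, η, hb, hη, H⟩ := hU.exists_realize {φ' | φ.IsApprox φ'}
      Set.univ (Set.range Fin.castSucc) a (Fin.snoc ξ β₀) (fun q hq hqf => by
        obtain ⟨φ', h', H⟩ := φ.exists_isApprox_forall_mem (M := U) PEmpty.elim hqf hq
        obtain ⟨β, hβ⟩ := h _ (.exSpace h')
        exact ⟨a, _, by simp, by rintro _ ⟨i, rfl⟩; simp, H _ _ hβ⟩)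
    obtain rfl : b = a := funext fun j => hb j trivial
    obtain rfl : Fin.init η = ξ := funext fun i => by simpa [Fin.init] using hη i.castSucc ⟨i, rfl⟩
    refine ⟨η (Fin.last k), ih _ _ fun φ' h' => ?_⟩
    rw [Fin.snoc_init_self]
    exact H φ' h'

end Saturation

/-! ### The Tarski–Vaught test -/

section TarskiVaught

theorem snoc_coe {L : FirstOrder.Language.{u, u}} {U : Type u} [L.Structure U]
    {S : L.Substructure U} {n : ℕ} (a : Fin n → S) (b : S) :
    (fun i => ((Fin.snoc a b : Fin (n + 1) → S) i : U)) =
      Fin.snoc (fun i => (a i : U)) (b : U) :=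
  Fin.comp_snoc (Subtype.val : S → U) a b

variable {X : Type u} [TopologicalSpace X] {L : TwoSortedLanguage X} {U : Type u}
  [L.StandardStructure U]

/-- The Tarski–Vaught condition on a subset `N` of `U`: if `∃ x, φ(x)` holds in `U`, where `φ` has
parameters in `N`, then every `φ' > φ` is satisfied by an element of `N`. -/
def IsTarskiVaught (L : TwoSortedLanguage X) {U : Type u} [L.StandardStructure U]
    (N : Set U) : Prop :=
  ∀ (n : ℕ) (φ φ' : L.FFormula PEmpty.{u + 1} (n + 1) 0), φ.IsApprox φ' →
    ∀ (a : Fin n → U) (ξ : Fin 0 → X), (∀ i, a i ∈ N) →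
      (∃ b, φ.Realize PEmpty.elim (Fin.snoc a b) ξ) →
      ∃ b ∈ N, φ'.Realize PEmpty.elim (Fin.snoc a b) ξ

/-- In a separable language, witnesses for the formulas of the countable set `F₀` suffice. -/
theorem IsSeparable.exists_isTarskiVaught [Nonempty U] (hL : L.IsSeparable) (A : Set U)
    (hA : A.Countable) : ∃ N : Set U, L.IsTarskiVaught N ∧ A ⊆ N ∧ N.Countable := by
  obtain ⟨F₀, hF₀, hF⟩ := hL
  let W (n : ℕ) : Type u := {φ : L.FFormula PEmpty.{u + 1} (n + 1) 0 //
    (⟨(n + 1, 0), φ⟩ : Σ nk : ℕ × ℕ, L.FFormula PEmpty.{u + 1} nk.1 nk.2) ∈ F₀}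
  have hW : Countable (Σ n, W n) := by
    have := hF₀.to_subtype
    refine Function.Injective.countable (β := F₀) (f := fun w => ⟨⟨(w.1 + 1, 0), w.2.1⟩, w.2.2⟩) ?_
    rintro ⟨n, φ, hφ⟩ ⟨m, ψ, hψ⟩ h
    simp only [Subtype.mk.injEq, Sigma.mk.injEq, Prod.mk.injEq, and_true] at h
    obtain ⟨h₁, h₂⟩ := h
    obtain rfl : n = m := by simpa using h₁
    obtain rfl := eq_of_heq h₂
    rfl
  -- A language of Skolem functions for the formulas in `F₀`.
  let K : FirstOrder.Language.{u, 0} := ⟨W, fun _ => Empty⟩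
  have hK : Countable (Σ n, K.Functions n) := hW
  let _ : K.Structure U :=
    { funMap := fun φ a => Classical.epsilon fun b => φ.1.Realize PEmpty.elim (Fin.snoc a b)
        Fin.elim0
      RelMap := fun r => r.elim }
  refine ⟨FirstOrder.Language.Substructure.closure K A, ?_,
    FirstOrder.Language.Substructure.subset_closure, (hA.substructure_closure K).to_set⟩
  rintro n φ φ' h a ξ ha ⟨b, hb⟩
  obtain ⟨φ₀, hφ₀, h₁, h₂⟩ := hF _ _ φ φ' h
  obtain rfl : ξ = Fin.elim0 := Subsingleton.elim _ _
  exact ⟨_, FirstOrder.Language.Substructure.fun_mem _ (show K.Functions n from ⟨φ₀, hφ₀⟩) a ha,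
    h₂ U _ _ (Classical.epsilon_spec (p := fun b => φ₀.Realize PEmpty.elim (Fin.snoc a b)
      Fin.elim0) ⟨b, h₁ U _ _ hb⟩)⟩

theorem IsTarskiVaught.exists_home {N : Set U} (hN : L.IsTarskiVaught N) {n : ℕ}
    (φ : L.home.BoundedFormula PEmpty.{u + 1} (n + 1)) (a : Fin n → U) (ha : ∀ i, a i ∈ N)
    (h : ∃ b, φ.Realize PEmpty.elim (Fin.snoc a b : Fin (n + 1) → U)) :
    ∃ b ∈ N, φ.Realize PEmpty.elim (Fin.snoc a b : Fin (n + 1) → U) :=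
  hN n (.home φ) (.home φ) (.home φ) a Fin.elim0 ha h

theorem IsTarskiVaught.fun_mem {N : Set U} (hN : L.IsTarskiVaught N) {n : ℕ}
    (f : L.home.Functions n) (a : Fin n → U) (ha : ∀ i, a i ∈ N) :
    FirstOrder.Language.Structure.funMap f a ∈ N := by
  obtain ⟨b, hb, h⟩ := hN.exists_home
    ((FirstOrder.Language.Term.var (.inr (Fin.last n))).bdEqual
      (.func f fun i => .var (.inr i.castSucc))) a ha
    ⟨FirstOrder.Language.Structure.funMap f a, by simp⟩
  simp only [FirstOrder.Language.BoundedFormula.realize_bdEqual,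
    FirstOrder.Language.Term.realize_var, FirstOrder.Language.Term.realize_func, Sum.elim_inr,
    Fin.snoc_last, Fin.snoc_castSucc] at h
  exact h ▸ hb

theorem IsTarskiVaught.nonempty {N : Set U} (hN : L.IsTarskiVaught N) [Nonempty U] :
    N.Nonempty := by
  obtain ⟨b, hb, -⟩ := hN.exists_home (n := 0) ⊤ Fin.elim0 (fun i => i.elim0)
    ⟨Classical.arbitrary U, by simp⟩
  exact ⟨b, hb⟩

variable {S : L.home.Substructure U}

theorem IsTarskiVaught.isElementary (hS : L.IsTarskiVaught (S : Set U)) : S.IsElementary := by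
  refine S.isElementary_of_exists fun n φ a b h => ?_
  have key (x : Fin (n + 1) → U) : (φ.subst Empty.elim).Realize PEmpty.elim x ↔
      φ.Realize default x := by
    rw [FirstOrder.Language.BoundedFormula.realize_subst]
    exact iff_of_eq (congrArg₂ _ (Subsingleton.elim _ _) rfl)
  obtain ⟨c, hc, h'⟩ := hS.exists_home (φ.subst Empty.elim) (fun i => (a i : U))
    (fun i => (a i).2) ⟨b, (key _).2 h⟩
  exact ⟨⟨c, hc⟩, (key _).1 h'⟩

theorem SpaceTerm.realize_substructure {n k : ℕ} (t : L.SpaceTerm PEmpty.{u + 1} n k)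
    (a : Fin n → S) (ξ : Fin k → X) :
    t.realize PEmpty.elim a ξ = t.realize PEmpty.elim (fun i => (a i : U)) ξ := by
  induction t with
  | var i => rfl
  | ofHome f t =>
    simp only [SpaceTerm.realize]
    change StandardStructure.spaceMap f (fun i => S.subtype ((t i).realize _)) = _
    congr 1
    funext i
    refine (FirstOrder.Language.HomClass.realize_term S.subtype).symm.trans ?_
    congr 1
    funext j
    rcases j with j | j
    · exact j.elim
    · rfl
  | func f t ih => simp only [SpaceTerm.realize, ih]

/-- Truth in a Tarski–Vaught substructure passes to `U` up to approximation. The main case is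
the quantifier `∀` of the home sort. If `φ'(a, b, ξ)` fails for some `b` in `U`, then a strong
negation of `φ` holds at `(a, b, ξ)`. The points `ξ` may be turned into closed terms, so
the Tarski–Vaught condition provides `b` in the substructure with a slightly weaker property,
which still refutes some `φ'' > φ` at `(a, b, ξ)`. -/
theorem IsTarskiVaught.realize_of_isApprox [CompactSpace X] [T2Space X]
    (hS : L.IsTarskiVaught (S : Set U)) {n k : ℕ} {φ φ' : L.FFormula PEmpty.{u + 1} n k}
    (h : φ.IsApprox φ') (a : Fin n → S) (ξ : Fin k → X) (ha : φ.Realize PEmpty.elim a ξ) :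
    φ'.Realize PEmpty.elim (fun i => (a i : U)) ξ := by
  induction φ with
  | home φ =>
    cases h
    have := (FirstOrder.Language.ElementaryEmbedding.map_boundedFormula
      (FirstOrder.Language.ElementarySubstructure.subtype ⟨S, hS.isElementary⟩) φ
      PEmpty.elim a).2 ha
    rwa [Subsingleton.elim (_ ∘ PEmpty.elim) PEmpty.elim] at this
  | mem t C =>
    cases h with
    | mem _ _ C' h =>
      simp only [FFormula.Realize, SpaceTerm.realize_substructure] at ha
      exact subset_of_mem_nhdsSet h ha
  | and _ _ ih₁ ih₂ =>
    cases h with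
    | and h₁ h₂ => exact ⟨ih₁ h₁ a ξ ha.1, ih₂ h₂ a ξ ha.2⟩
  | or _ _ ih₁ ih₂ =>
    cases h with
    | or h₁ h₂ => exact ha.imp (ih₁ h₁ a ξ) (ih₂ h₂ a ξ)
  | @allHome n k φ ih =>
    cases h with
    | @allHome _ _ _ φ' h =>
      by_contra hw
      simp only [FFormula.Realize] at hw
      push Not at hw
      obtain ⟨b, hb⟩ := hw
      obtain ⟨φ'', ψ, ψ', h', hψ, H⟩ := h.exists_strong_negation (M := U) PEmpty.elim
      have key (χ : L.FFormula PEmpty.{u + 1} (n + 1) k) (x : Fin (n + 1) → U) :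
          (χ.subst id fun i => (.inr (ξ i) : Fin 0 ⊕ X)).Realize PEmpty.elim x Fin.elim0 ↔
            χ.Realize PEmpty.elim x ξ :=
        FFormula.realize_subst _ _ _ _ _ _
      obtain ⟨d, hd, hdψ⟩ := hS n _ _ (hψ.subst id fun i => (.inr (ξ i) : Fin 0 ⊕ X))
        (fun i => (a i : U)) Fin.elim0 (fun i => (a i).2)
        ⟨b, (key _ _).2 ((H _ _).1.resolve_left hb)⟩
      have hdφ := ih h' _ ξ (ha ⟨d, hd⟩)
      rw [snoc_coe] at hdφ
      exact (H _ _).2 ⟨hdφ, (key _ _).1 hdψ⟩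
  | exHome φ ih =>
    cases h with
    | exHome h =>
      obtain ⟨b, hb⟩ := ha
      have := ih h _ ξ hb
      rw [snoc_coe] at this
      exact ⟨b, this⟩
  | allSpace φ ih =>
    cases h with
    | allSpace h => exact fun β => ih h a _ (ha β)
  | exSpace φ ih =>
    cases h with
    | exSpace h => exact ha.imp fun β => ih h a _

end TarskiVaught

end TwoSortedLanguage

theorem mainTheorem9 {X : Type u} [TopologicalSpace X] [CompactSpace X] [T2Space X] [Nonempty X]
    (L : TwoSortedLanguage X) (hL : L.IsSeparable)
    (U : Type u) [L.StandardStructure U] (hU : L.IsMonster U)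
    (A : Set U) (hA : A.Countable) :
    ∃ M : L.home.Substructure U, L.IsModel M ∧ A ⊆ (M : Set U) ∧ (M : Set U).Countable := by
  have := hU.infinite
  obtain ⟨N, hN, hAN, hNc⟩ := hL.exists_isTarskiVaught A hA
  refine ⟨⟨N, fun f a ha => hN.fun_mem f a ha⟩, ⟨hN.nonempty, fun n φ a ξ ha => ?_⟩, hAN, hNc⟩
  exact hU.2.realize_of_forall_isApprox φ _ ξ fun φ' h =>
    TwoSortedLanguage.IsTarskiVaught.realize_of_isApprox hN h a ξ ha
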